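/- A (commutative) residuated lattice is an algebra $\mathbf{A}=\langle A;\cdot,\to,\wedge,\vee,e\rangle$ such that $\langle A;\cdot,e\rangle$ is a commutative monoid, $\langle A;\wedge,\vee\rangle$ is a lattice with associated order $\leqslant$, and $x\cdot y\leqslant z \iff y\leqslant x\to z$ for all $x,y,z\in A$. It is idempotent if $a\cdot a=a$ for all $a\in A$, and semilinear if it is isomorphic to a subdirect product of totally ordered residuated lattices. Homomorphisms preserve all of the operations $\cdot,\to,\wedge,\vee,e$. Let $\mathsf{K}$ be the variety of all idempotent semilinear (commutative) residuated lattices. Then epimorphisms are surjective in $\mathsf{K}$. That is, if $\mathbf{A},\mathbf{B}\in\mathsf{K}$ and $f\colon\mathbf{A}\to\mathbf{B}$ is a homomorphism such that, for every $\mathbf{C}\in\mathsf{K}$ and all homomorphisms $g,h\colon\mathbf{B}\to\mathbf{C}$, $g\circ f=h\circ f$ implies $g=h$, then $f$ is surjective. -/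

import Mathlib

universe u v w

/-- A (commutative) residuated lattice: a commutative monoid and a lattice on the same set,
with a residual `⇨` satisfying the law of residuation. -/
class ResiduatedLattice (A : Type u) extends CommMonoid A, Lattice A, HImp A where
  mul_le_iff_le_himp : ∀ x y z : A, x * y ≤ z ↔ y ≤ x ⇨ z

namespace ResiduatedLattice

/-- Homomorphisms: maps preserving all the operations `*`, `⇨`, `⊓`, `⊔` and `1`. -/
@[ext]
structure Hom (A : Type u) (B : Type v) [ResiduatedLattice A] [ResiduatedLattice B] where
  toFun : A → B
  map_mul : ∀ x y, toFun (x * y) = toFun x * toFun y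
  map_himp : ∀ x y, toFun (x ⇨ y) = (toFun x ⇨ toFun y)
  map_inf : ∀ x y, toFun (x ⊓ y) = toFun x ⊓ toFun y
  map_sup : ∀ x y, toFun (x ⊔ y) = toFun x ⊔ toFun y
  map_one : toFun 1 = 1

instance {A : Type u} {B : Type v} [ResiduatedLattice A] [ResiduatedLattice B] :
    FunLike (Hom A B) A B where
  coe := Hom.toFun
  coe_injective _ _ h := Hom.ext h

/-- Composition of homomorphisms. -/
def Hom.comp {A : Type u} {B : Type v} {C : Type w} [ResiduatedLattice A] [ResiduatedLattice B]
    [ResiduatedLattice C] (g : Hom B C) (f : Hom A B) : Hom A C where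
  toFun x := g.toFun (f.toFun x)
  map_mul x y := by rw [f.map_mul, g.map_mul]
  map_himp x y := by rw [f.map_himp, g.map_himp]
  map_inf x y := by rw [f.map_inf, g.map_inf]
  map_sup x y := by rw [f.map_sup, g.map_sup]
  map_one := by rw [f.map_one, g.map_one]

/-- The direct product of a family of residuated lattices, with pointwise operations. -/
instance instPi {ι : Type v} {B : ι → Type w} [∀ i, ResiduatedLattice (B i)] :
    ResiduatedLattice (∀ i, B i) where
  toCommMonoid := inferInstance
  toLattice := inferInstance
  toHImp := ⟨fun x y i => x i ⇨ y i⟩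
  mul_le_iff_le_himp x y z :=
    forall_congr' fun i => mul_le_iff_le_himp (x i) (y i) (z i)

/-- Every element is idempotent for the monoid operation. -/
def IsIdempotent (A : Type u) [ResiduatedLattice A] : Prop :=
  ∀ a : A, a * a = a

/-- The lattice order is total. -/
def IsTotallyOrdered (A : Type u) [ResiduatedLattice A] : Prop :=
  ∀ a b : A, a ≤ b ∨ b ≤ a

/-- `A` is isomorphic to a subdirect product of totally ordered residuated lattices: it embeds
into a direct product of such algebras in such a way that every coordinate map is onto.
(As the factors are images of `A`, and as one factor for each congruence of `A` is enough,
indices and factors in the universe of `A` suffice.) -/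
def IsSemilinear (A : Type u) [ResiduatedLattice A] : Prop :=
  ∃ (ι : Type u) (B : ι → Type u) (_ : ∀ i, ResiduatedLattice (B i)) (φ : Hom A (∀ i, B i)),
    (∀ i, IsTotallyOrdered (B i)) ∧ Function.Injective φ ∧
      ∀ i, Function.Surjective fun a => φ a i

/-- `f` is an epimorphism of the class `K`: it is right cancellable with respect to
homomorphisms into members of `K`. (Its domain and co-domain are meant to belong to `K`.) -/
def IsEpimorphism (K : ∀ (A : Type u) [ResiduatedLattice A], Prop) {A B : Type u}
    [ResiduatedLattice A] [ResiduatedLattice B] (f : Hom A B) : Prop :=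
  ∀ (C : Type u) [ResiduatedLattice C], K C →
    ∀ g h : Hom B C, g.comp f = h.comp f → g = h

/-- The epimorphism-surjectivity property of a class `K` of residuated lattices: every
`K`-epimorphism between members of `K` is surjective. -/
def HasSurjectiveEpimorphisms (K : ∀ (A : Type u) [ResiduatedLattice A], Prop) : Prop :=
  ∀ (A B : Type u) [ResiduatedLattice A] [ResiduatedLattice B], K A → K B →
    ∀ f : Hom A B, IsEpimorphism K f → Function.Surjective f

/-- The class of all idempotent semilinear residuated lattices. -/
def IsIdempotentSemilinear (A : Type u) [ResiduatedLattice A] : Prop :=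
  IsIdempotent A ∧ IsSemilinear A

end ResiduatedLattice

/-! Surjectivity is tested on pairs of totally ordered quotients of `B`, then globalised by
compactness.

On an idempotent chain the product and the residual are determined by the order, `1` and the star `x
⇨ 1`. Chains with a star amalgamate strongly (`IsStar.exists_amalgam`, hence `exists_amalgam`). So
if two total quotients of `B`, by filters `F` and `G`, induce the same congruence on `A`, cancelling
`f` shows that each `b` agrees with a single `f a` modulo both. For arbitrary total `F` and `G`, a
Chinese-remainder argument reduces to this case by enlarging the filters
(`IsEpimorphism.exists_rel`).

Finally, `B` embeds in a product of chains, and each ultrafilter on the index set gives a total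
quotient. Hence for ultrafilters `U`, `V` some `a` has `b ≤ f a` almost everywhere for `U` and `f a
≤ b` almost everywhere for `V`. In the manner of Baker and Pixley, finite meets remove the
dependence on `V`, and then finite joins that on `U`. -/

namespace ResiduatedLattice

/-! ### Strong amalgamation of linear orders -/

/-- Linear orders have the strong amalgamation property. -/
theorem exists_linearOrder_amalgam {A : Type v} {X Y : Type u} [LinearOrder X] [LinearOrder Y]
    (α : A → X) (β : A → Y) (h : ∀ a a', α a ≤ α a' ↔ β a ≤ β a') :
    ∃ (L : Type u) (_ : LinearOrder L) (f : X → L) (g : Y → L), StrictMono f ∧ StrictMono g ∧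
      (∀ a, f (α a) = g (β a)) ∧ ∀ x y, f x = g y → ∃ a, x = α a ∧ y = β a := by
  classical
  -- The cut that a point makes in the common part. Cuts from both sides are coded as lower sets of
  -- `X`, which are linearly ordered by inclusion.
  let cX : X → LowerSet X := fun x =>
    ⟨{z | ∃ a, z ≤ α a ∧ α a ≤ x}, fun z z' hz ⟨a, h1, h2⟩ => ⟨a, hz.trans h1, h2⟩⟩
  let cY : Y → LowerSet X := fun y =>
    ⟨{z | ∃ a, z ≤ α a ∧ β a ≤ y}, fun z z' hz ⟨a, h1, h2⟩ => ⟨a, hz.trans h1, h2⟩⟩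
  -- Tie-break among points with the same cut: a common point is least among them, hence `⊥`; the
  -- other points of `X` go below those of `Y`.
  let tX : X → WithBot (X ⊕ₗ Y) := fun x => if ∃ a, x = α a then ⊥ else
    ((toLex (Sum.inl x) : X ⊕ₗ Y) : WithBot (X ⊕ₗ Y))
  let tY : Y → WithBot (X ⊕ₗ Y) := fun y => if ∃ a, y = β a then ⊥ else
    ((toLex (Sum.inr y) : X ⊕ₗ Y) : WithBot (X ⊕ₗ Y))
  have hcX : ∀ x x', x ≤ x' → cX x ≤ cX x' := fun x x' hx z ⟨a, h1, h2⟩ => ⟨a, h1, h2.trans hx⟩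
  have hcY : ∀ x x', x ≤ x' → cY x ≤ cY x' := fun x x' hx z ⟨a, h1, h2⟩ => ⟨a, h1, h2.trans hx⟩
  have mX : ∀ a x, cX (α a) ≤ cX x → α a ≤ x := fun a x hh => by
    obtain ⟨b, h1, h2⟩ := hh (show α a ∈ cX (α a) from ⟨a, le_rfl, le_rfl⟩)
    exact h1.trans h2
  have mY : ∀ a y, cY (β a) ≤ cY y → β a ≤ y := fun a x hh => by
    obtain ⟨b, h1, h2⟩ := hh (show α a ∈ cY (β a) from ⟨a, le_rfl, le_rfl⟩)
    exact ((h _ _).1 h1).trans h2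
  have hXY : ∀ a, cX (α a) = cY (β a) := fun a => by
    ext z
    exact ⟨fun ⟨b, h1, h2⟩ => ⟨b, h1, (h _ _).1 h2⟩, fun ⟨b, h1, h2⟩ => ⟨b, h1, (h _ _).2 h2⟩⟩
  refine ⟨LowerSet X ×ₗ WithBot (X ⊕ₗ Y), inferInstance, fun x => toLex (cX x, tX x),
    fun y => toLex (cY y, tY y), ?_, ?_, ?_, ?_⟩
  · intro x x' hx
    rw [Prod.Lex.toLex_lt_toLex]
    rcases (hcX x x' hx.le).lt_or_eq with h1 | h1
    · exact Or.inl h1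
    · refine Or.inr ⟨h1, ?_⟩
      have h2 : ¬ ∃ a, x' = α a := by
        rintro ⟨a, rfl⟩
        exact absurd (mX a x h1.ge) (not_le.2 hx)
      by_cases h3 : ∃ a, x = α a
      · simp [tX, h2, h3]
      · simp only [tX, h2, h3, if_false]
        exact WithBot.coe_lt_coe.2 (Sum.Lex.inl_lt_inl_iff.2 hx)
  · intro x x' hx
    rw [Prod.Lex.toLex_lt_toLex]
    rcases (hcY x x' hx.le).lt_or_eq with h1 | h1
    · exact Or.inl h1
    · refine Or.inr ⟨h1, ?_⟩
      have h2 : ¬ ∃ a, x' = β a := by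
        rintro ⟨a, rfl⟩
        exact absurd (mY a x h1.ge) (not_le.2 hx)
      by_cases h3 : ∃ a, x = β a
      · simp [tY, h2, h3]
      · simp only [tY, h2, h3, if_false]
        exact WithBot.coe_lt_coe.2 (Sum.Lex.inr_lt_inr_iff.2 hx)
  · intro a
    have h1 : tX (α a) = ⊥ := if_pos ⟨a, rfl⟩
    have h2 : tY (β a) = ⊥ := if_pos ⟨a, rfl⟩
    simp only [hXY, h1, h2]
  · intro x y hxy
    have h1 : cX x = cY y := congrArg (fun p => (ofLex p).1) hxy
    have h2 : tX x = tY y := congrArg (fun p => (ofLex p).2) hxy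
    by_cases h3 : ∃ a, x = α a
    · by_cases h4 : ∃ a, y = β a
      · obtain ⟨a, rfl⟩ := h3
        obtain ⟨b, rfl⟩ := h4
        refine ⟨a, rfl, le_antisymm ?_ ?_⟩
        · exact (h _ _).1 (mX b _ (by rw [hXY b, h1]))
        · exact mY a _ (by rw [← hXY a, h1])
      · simp [tX, tY, h3, h4] at h2
    · by_cases h4 : ∃ a, y = β a
      · simp [tX, tY, h3, h4] at h2
      · simp [tX, tY, h3, h4] at h2

/-! ### Chains with a star operation and their strong amalgamation -/

/-- A linear order with an antitone Galois connection with itself that fixes the element `e`. -/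
structure IsStar {X : Type u} [LinearOrder X] (e : X) (s : X → X) : Prop where
  le_iff : ∀ x y, x ≤ s y ↔ y ≤ s x
  map_e : s e = e

namespace IsStar

variable {X : Type u} [LinearOrder X] {e : X} {s : X → X}

theorem le_star_star (h : IsStar e s) (x : X) : x ≤ s (s x) := (h.le_iff _ _).1 le_rfl

theorem anti (h : IsStar e s) {x y : X} (hxy : x ≤ y) : s y ≤ s x :=
  (h.le_iff _ _).1 (hxy.trans (h.le_star_star y))

theorem star_star_star (h : IsStar e s) (x : X) : s (s (s x)) = s x :=
  le_antisymm (h.anti (h.le_star_star x)) (h.le_star_star _)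

theorem e_le_star (h : IsStar e s) (x : X) : e ≤ s x ↔ x ≤ e := by
  rw [h.le_iff, h.map_e]

/-- The multiplication determined by a star operation. -/
def mul (s : X → X) (x y : X) : X := if x ≤ s y then x ⊓ y else x ⊔ y

theorem mul_comm (h : IsStar e s) (x y : X) : mul s x y = mul s y x := by
  simp only [mul, h.le_iff x y, inf_comm, sup_comm]

/-- The product always selects one of its arguments, so associativity reduces to transitivity of the
relation "`x` is selected against `y`". -/
theorem mul_trans (h : IsStar e s) {x y z : X}
    (hxy : mul s x y = x) (hyz : mul s y z = y) : mul s x z = x := by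
  have h1 := h.e_le_star x
  have h2 := h.e_le_star y
  have h3 := h.e_le_star z
  have a1 := @IsStar.anti _ _ _ _ h x y
  have a2 := @IsStar.anti _ _ _ _ h y x
  have a3 := @IsStar.anti _ _ _ _ h y z
  have a4 := @IsStar.anti _ _ _ _ h z y
  have g1 := h.le_iff x y
  have g2 := h.le_iff y z
  have g3 := h.le_iff x z
  rw [mul] at *
  grind

/-- The residuated lattice determined by a linear order with a star operation. -/
@[reducible] def residuatedLattice (h : IsStar e s) : ResiduatedLattice X where
  mul := mul s
  one := e
  mul_assoc x y z := by
    change mul s (mul s x y) z = mul s x (mul s y z)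
    have hs : ∀ x y, mul s x y = x ∨ mul s x y = y := fun x y => by
      rw [mul]; grind
    rcases hs x y with h1 | h1 <;> rcases hs y z with h2 | h2
    · rw [h1, h2, h1, h.mul_trans h1 h2]
    · rw [h1, h2]
    · rw [h1, h2, h1]
    · rw [h1, h2, h.mul_comm x z]
      exact (h.mul_trans ((h.mul_comm z y).trans h2) ((h.mul_comm y x).trans h1)).symm
  mul_comm := h.mul_comm
  one_mul x := by
    change mul s e x = x
    rw [mul]
    split_ifs with h1
    · exact inf_eq_right.2 ((h.e_le_star x).1 h1)
    · exact sup_eq_right.2 (le_of_not_ge fun h2 => h1 ((h.e_le_star x).2 h2))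
  mul_one x := by
    change mul s x e = x
    rw [mul, h.map_e]
    split_ifs with h1
    · exact inf_eq_left.2 h1
    · exact sup_eq_left.2 (le_of_not_ge h1)
  himp x y := if x ≤ y then s x ⊔ y else s x ⊓ y
  mul_le_iff_le_himp x y z := by
    change (if x ≤ s y then x ⊓ y else x ⊔ y) ≤ z ↔ y ≤ (if x ≤ z then s x ⊔ z else s x ⊓ z)
    have := h.le_iff x y
    grind

end IsStar

/-- Linear orders with a star operation have the strong amalgamation property. -/
theorem IsStar.exists_amalgam {A X Y : Type u} [LinearOrder X] [LinearOrder Y]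
    {e : X} {s : X → X} {e' : Y} {s' : Y → Y} (hs : IsStar e s) (hs' : IsStar e' s')
    (α : A → X) (β : A → Y) (h : ∀ a a', α a ≤ α a' ↔ β a ≤ β a')
    (he : ∃ a, α a = e ∧ β a = e') (hst : ∀ a, ∃ a', α a' = s (α a) ∧ β a' = s' (β a)) :
    ∃ (E : Type u) (_ : LinearOrder E) (i : E) (t : E → E) (_ : IsStar i t)
      (f : X → E) (g : Y → E), StrictMono f ∧ StrictMono g ∧
      f e = i ∧ g e' = i ∧ (∀ x, f (s x) = t (f x)) ∧ (∀ y, g (s' y) = t (g y)) ∧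
      (∀ a, f (α a) = g (β a)) ∧ ∀ x y, f x = g y → ∃ a, x = α a ∧ y = β a := by
  classical
  obtain ⟨L, _, f, g, hf, hg, hfg, hfg'⟩ := exists_linearOrder_amalgam α β h
  -- The order of `L` need not respect the stars across `X` and `Y`. Here the star swaps the first
  -- two coordinates up to duality; the third keeps the map injective.
  let F : X → L ×ₗ Lᵒᵈ ×ₗ L := fun x => toLex (f (s (s x) ⊔ e),
    toLex (OrderDual.toDual (f (s x ⊔ e)), f x))
  let G : Y → L ×ₗ Lᵒᵈ ×ₗ L := fun y => toLex (g (s' (s' y) ⊔ e'),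
    toLex (OrderDual.toDual (g (s' y ⊔ e')), g y))
  have hF : StrictMono F := by
    refine Monotone.strictMono_of_injective (fun x x' hx => Prod.Lex.toLex_mono ⟨?_, ?_⟩) ?_
    · exact hf.monotone (sup_le_sup_right (hs.anti (hs.anti hx)) _)
    · refine Prod.Lex.toLex_mono ⟨?_, hf.monotone hx⟩
      exact OrderDual.toDual_le_toDual.2 (hf.monotone (sup_le_sup_right (hs.anti hx) _))
    · exact fun x x' hx => hf.injective (congrArg (fun p => (ofLex (ofLex p).2).2) hx)
  have hG : StrictMono G := by
    refine Monotone.strictMono_of_injective (fun x x' hx => Prod.Lex.toLex_mono ⟨?_, ?_⟩) ?_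
    · exact hg.monotone (sup_le_sup_right (hs'.anti (hs'.anti hx)) _)
    · refine Prod.Lex.toLex_mono ⟨?_, hg.monotone hx⟩
      exact OrderDual.toDual_le_toDual.2 (hg.monotone (sup_le_sup_right (hs'.anti hx) _))
    · exact fun x x' hx => hg.injective (congrArg (fun p => (ofLex (ofLex p).2).2) hx)
  have hFG' : ∀ x y, F x = G y → ∃ a, x = α a ∧ y = β a := fun x y hxy =>
    hfg' x y (congrArg (fun p => (ofLex (ofLex p).2).2) hxy)
  have hstar : ∀ x y, f x = g y → f (s x) = g (s' y) := by
    intro x y hxy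
    obtain ⟨a, rfl, rfl⟩ := hfg' x y hxy
    obtain ⟨a', h1, h2⟩ := hst a
    rw [← h1, ← h2, hfg]
  have hee : f e = g e' := by
    obtain ⟨a, rfl, rfl⟩ := he
    exact hfg a
  have hsup : ∀ x y, f x = g y → f (x ⊔ e) = g (y ⊔ e') := fun x y hxy => by
    rw [hf.monotone.map_sup, hg.monotone.map_sup, hxy, hee]
  have hFG : ∀ a, F (α a) = G (β a) := fun a => by
    have h1 := hstar _ _ (hfg a)
    simp only [F, G, hfg, hsup _ _ h1, hsup _ _ (hstar _ _ h1)]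
  have hcross : ∀ x y, F x ≤ G (s' y) ↔ G y ≤ F (s x) := by
    intro x y
    -- A tie in the first two coordinates. One of `s x`, `s (s x)` is at least `e` and the other at
    -- most `e`, so the ties identify the upper one with its counterpart in `Y`; by strongness it is
    -- a common element, and applying the stars identifies the lower one too. Then both inequalities
    -- of `hcross` hold.
    have key : f (s (s x) ⊔ e) = g (s' y ⊔ e') → f (s x ⊔ e) = g (s' (s' y) ⊔ e') →
        f (s (s x)) = g (s' y) ∧ f (s x) = g (s' (s' y)) := by
      intro h1 h2
      have h3 := hs.e_le_star (s x)
      have h4 := hs'.e_le_star (s' y)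
      have h5 := hs.e_le_star (s (s x))
      have h6 := hs'.e_le_star (s' (s' y))
      rw [hs.star_star_star] at h5
      rw [hs'.star_star_star] at h6
      rcases le_total e (s x) with h7 | h7
      · have h8 := h5.1 h7
        rw [sup_eq_right.2 h8, hee] at h1
        have h9 := sup_eq_right.1 (hg.injective h1.symm)
        rw [sup_eq_left.2 h7, sup_eq_left.2 (h4.2 h9)] at h2
        have h10 := hstar _ _ h2
        rw [hs'.star_star_star] at h10
        exact ⟨h10, h2⟩
      · rw [sup_eq_right.2 h7, hee] at h2
        have h9 := sup_eq_right.1 (hg.injective h2.symm)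
        rw [sup_eq_left.2 (h3.2 h7), sup_eq_left.2 (h6.2 h9)] at h1
        have h10 := hstar _ _ h1
        rw [hs.star_star_star] at h10
        exact ⟨h1, h10⟩
    have k1 : f (s (s x) ⊔ e) = g (s' y ⊔ e') → f (s x ⊔ e) = g (s' (s' y) ⊔ e') →
        f x ≤ g (s' y) ∧ g y ≤ f (s x) := fun h1 h2 => by
      obtain ⟨h3, h4⟩ := key h1 h2
      exact ⟨h3 ▸ hf.monotone (hs.le_star_star x), h4 ▸ hg.monotone (hs'.le_star_star y)⟩
    have k2 : f e ≤ f (s (s x) ⊔ e) := hf.monotone le_sup_right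
    have k3 : f e ≤ f (s x ⊔ e) := hf.monotone le_sup_right
    have k4 : f e ≤ g (s' y ⊔ e') := hee ▸ hg.monotone le_sup_right
    have k5 : f e ≤ g (s' (s' y) ⊔ e') := hee ▸ hg.monotone le_sup_right
    have k6 : f (s (s x) ⊔ e) = f e ∨ f (s x ⊔ e) = f e := by
      rcases le_total (s x) e with h7 | h7
      · exact Or.inr (by rw [sup_eq_right.2 h7])
      · exact Or.inl (by rw [sup_eq_right.2 ((hs.e_le_star _).1 (by rwa [hs.star_star_star]))])
    have k7 : g (s' (s' y) ⊔ e') = f e ∨ g (s' y ⊔ e') = f e := by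
      rcases le_total (s' y) e' with h7 | h7
      · exact Or.inr (by rw [sup_eq_right.2 h7, hee])
      · exact Or.inl (by
          rw [sup_eq_right.2 ((hs'.e_le_star _).1 (by rwa [hs'.star_star_star])), hee])
    simp only [F, G, Prod.Lex.toLex_le_toLex, OrderDual.toDual_lt_toDual, hs.star_star_star,
      hs'.star_star_star, OrderDual.toDual_inj]
    grind
  -- The star is only defined on the union of the two images, where it is well defined because they
  -- overlap only in the common part.
  let E := {k : L ×ₗ Lᵒᵈ ×ₗ L // (∃ x, F x = k) ∨ ∃ y, G y = k}
  let F' : X → E := fun x => ⟨F x, Or.inl ⟨x, rfl⟩⟩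
  let G' : Y → E := fun y => ⟨G y, Or.inr ⟨y, rfl⟩⟩
  have hE : ∀ k : E, (∃ x, F' x = k) ∨ ∃ y, G' y = k := by
    rintro ⟨k, ⟨x, hx⟩ | ⟨x, hx⟩⟩
    · exact Or.inl ⟨x, Subtype.ext hx⟩
    · exact Or.inr ⟨x, Subtype.ext hx⟩
  have ht : ∀ k : E, ∃ k' : E, (∀ x, F' x = k → F' (s x) = k') ∧ ∀ y, G' y = k → G' (s' y) = k' := by
    have aux : ∀ x y, F' x = G' y → F' (s x) = G' (s' y) := by
      intro x y hxy
      obtain ⟨a, rfl, rfl⟩ := hFG' x y (congrArg Subtype.val hxy)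
      obtain ⟨a', h1, h2⟩ := hst a
      rw [← h1, ← h2]
      exact Subtype.ext (hFG a')
    have iF : ∀ x x', F' x = F' x' → x = x' := fun x x' hx =>
      hF.injective (congrArg Subtype.val hx)
    have iG : ∀ x x', G' x = G' x' → x = x' := fun x x' hx =>
      hG.injective (congrArg Subtype.val hx)
    intro k
    rcases hE k with ⟨x, rfl⟩ | ⟨y, rfl⟩
    · exact ⟨F' (s x), fun x' hx => by rw [iF _ _ hx], fun y hy => (aux _ _ hy.symm).symm⟩
    · exact ⟨G' (s' y), fun x hx => aux _ _ hx, fun y' hy => by rw [iG _ _ hy]⟩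
  choose t htF htG using ht
  have htF' : ∀ x, t (F' x) = F' (s x) := fun x => (htF _ x rfl).symm
  have htG' : ∀ y, t (G' y) = G' (s' y) := fun y => (htG _ y rfl).symm
  have hGe : G' e' = F' e := by
    obtain ⟨a, rfl, rfl⟩ := he
    exact Subtype.ext (hFG a).symm
  refine ⟨E, inferInstance, F' e, t, ⟨?_, ?_⟩, F', G', hF, hG, rfl, hGe,
    fun x => (htF' x).symm, fun y => (htG' y).symm, fun a => Subtype.ext (hFG a),
    fun x y hxy => hFG' x y (congrArg Subtype.val hxy)⟩
  · intro k l
    rcases hE k with ⟨x, rfl⟩ | ⟨x, rfl⟩ <;> rcases hE l with ⟨y, rfl⟩ | ⟨y, rfl⟩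
    · rw [htF', htF']
      exact hF.le_iff_le.trans ((hs.le_iff x y).trans hF.le_iff_le.symm)
    · rw [htF', htG']
      exact hcross x y
    · rw [htF', htG']
      exact (hcross y x).symm
    · rw [htG', htG']
      exact hG.le_iff_le.trans ((hs'.le_iff x y).trans hG.le_iff_le.symm)
  · rw [htF', hs.map_e]

end ResiduatedLattice

namespace ResiduatedLattice

/-! ### Idempotent chains are chains with a star -/

section Basic

variable {A : Type u} [ResiduatedLattice A]

theorem mul_himp_le (x y : A) : x * (x ⇨ y) ≤ y := (mul_le_iff_le_himp _ _ _).2 le_rfl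

theorem le_himp_iff {x y z : A} : x ≤ y ⇨ z ↔ y * x ≤ z := (mul_le_iff_le_himp _ _ _).symm

theorem mul_le_mul_right_of_le {x y : A} (h : x ≤ y) (z : A) : x * z ≤ y * z := by
  rw [mul_comm x, mul_comm y, mul_le_iff_le_himp]
  exact h.trans (le_himp_iff.2 le_rfl)

theorem mul_le_mul_of_le {x y z w : A} (h : x ≤ y) (h' : z ≤ w) : x * z ≤ y * w := by
  refine (mul_le_mul_right_of_le h z).trans ?_
  rw [mul_comm y, mul_comm y]
  exact mul_le_mul_right_of_le h' y

theorem one_le_himp_iff {x y : A} : 1 ≤ x ⇨ y ↔ x ≤ y := by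
  rw [le_himp_iff, mul_one]

theorem one_himp (x : A) : (1 : A) ⇨ x = x :=
  le_antisymm (by simpa using mul_himp_le 1 x) (le_himp_iff.2 (by rw [one_mul]))

theorem himp_mul_himp_le (x y z : A) : (x ⇨ y) * (y ⇨ z) ≤ x ⇨ z := by
  rw [le_himp_iff, ← mul_assoc]
  exact (mul_le_mul_right_of_le (mul_himp_le x y) _).trans (mul_himp_le y z)

theorem le_star_comm {x y : A} : x ≤ y ⇨ 1 ↔ y ≤ x ⇨ 1 := by
  rw [le_himp_iff, le_himp_iff, mul_comm]

/-- The hypothesis says `x * y ≤ 1`; multiplying by it decreases, while `x * (x * y) = x * y`. -/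
theorem mul_eq_inf (hA : IsIdempotent A) {x y : A} (h : x ≤ y ⇨ 1) : x * y = x ⊓ y := by
  have h1 : x * y ≤ 1 := by rwa [mul_comm, ← le_himp_iff]
  refine le_antisymm (le_inf ?_ ?_) ?_
  · calc x * y = x * (x * y) := by rw [← mul_assoc, hA]
      _ = x * y * x := mul_comm _ _
      _ ≤ 1 * x := mul_le_mul_right_of_le h1 x
      _ = x := one_mul x
  · calc x * y = x * y * y := by rw [mul_assoc, hA]
      _ ≤ 1 * y := mul_le_mul_right_of_le h1 y
      _ = y := one_mul y
  · rw [← hA (x ⊓ y)]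
    exact mul_le_mul_of_le inf_le_left inf_le_right

theorem mul_eq_sup (hA : IsIdempotent A) (ht : IsTotallyOrdered A) {x y : A}
    (h : ¬ x ≤ y ⇨ 1) : x * y = x ⊔ y := by
  have h1 : 1 ≤ x * y := by
    refine (ht 1 (x * y)).resolve_right fun h2 => h ?_
    rwa [le_himp_iff, mul_comm]
  refine le_antisymm ?_ (sup_le ?_ ?_)
  · rw [← hA (x ⊔ y)]
    exact mul_le_mul_of_le le_sup_left le_sup_right
  · calc x = 1 * x := (one_mul x).symm
      _ ≤ x * y * x := mul_le_mul_right_of_le h1 x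
      _ = x * y := by rw [mul_comm, ← mul_assoc, hA]
  · calc y = 1 * y := (one_mul y).symm
      _ ≤ x * y * y := mul_le_mul_right_of_le h1 y
      _ = x * y := by rw [mul_assoc, hA]

/-- If `x ⇨ y` is not below `x ⇨ 1`, its product with `x` is a join, and residuation forces `x ⇨ y ≤
y`. -/
theorem himp_eq_sup (hA : IsIdempotent A) (ht : IsTotallyOrdered A) {x y : A} (h : x ≤ y) :
    x ⇨ y = (x ⇨ 1) ⊔ y := by
  refine le_antisymm ?_ (sup_le ?_ ?_)
  · by_cases h1 : x ⇨ y ≤ x ⇨ 1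
    · exact le_sup_of_le_left h1
    · have h2 := mul_himp_le x y
      rw [mul_comm, mul_eq_sup hA ht h1] at h2
      exact le_sup_of_le_right (le_sup_left.trans h2)
  · rw [le_himp_iff, mul_comm, mul_eq_inf hA le_rfl]
    exact inf_le_right.trans h
  · rw [le_himp_iff]
    by_cases h1 : x ≤ y ⇨ 1
    · rw [mul_eq_inf hA h1]
      exact inf_le_right
    · rw [mul_eq_sup hA ht h1]
      exact sup_le h le_rfl

theorem himp_eq_inf (hA : IsIdempotent A) (ht : IsTotallyOrdered A) {x y : A} (h : ¬ x ≤ y) :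
    x ⇨ y = (x ⇨ 1) ⊓ y := by
  have h2 := mul_himp_le x y
  rw [mul_comm] at h2
  refine le_antisymm ?_ ?_
  · by_cases h1 : x ⇨ y ≤ x ⇨ 1
    · rw [mul_eq_inf hA h1] at h2
      refine le_inf h1 ?_
      rcases ht x (x ⇨ y) with h3 | h3
      · exact absurd ((le_inf h3 le_rfl).trans h2) h
      · exact (le_inf le_rfl h3).trans h2
    · rw [mul_eq_sup hA ht h1] at h2
      exact absurd (le_sup_right.trans h2) h
  · rw [le_himp_iff, mul_comm, mul_eq_inf hA inf_le_left]
    exact inf_le_left.trans inf_le_right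

/-- A strictly monotone map from an idempotent totally ordered residuated lattice that preserves
the unit and the star operation is a homomorphism. -/
def starHom (hA : IsIdempotent A) (ht : IsTotallyOrdered A) {E : Type v} [LinearOrder E] {i : E}
    {t : E → E} (h : IsStar i t) (f : A → E) (hf : ∀ x y, x ≤ y ↔ f x ≤ f y) (hf1 : f 1 = i)
    (hft : ∀ x, f (x ⇨ 1) = t (f x)) : @Hom A E _ h.residuatedLattice := by
  letI := h.residuatedLattice
  have hinf : ∀ x y, f (x ⊓ y) = f x ⊓ f y := fun x y => by
    rcases ht x y with h1 | h1
    · rw [inf_eq_left.2 h1, inf_eq_left.2 ((hf _ _).1 h1)]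
    · rw [inf_eq_right.2 h1, inf_eq_right.2 ((hf _ _).1 h1)]
  have hsup : ∀ x y, f (x ⊔ y) = f x ⊔ f y := fun x y => by
    rcases ht x y with h1 | h1
    · rw [sup_eq_right.2 h1, sup_eq_right.2 ((hf _ _).1 h1)]
    · rw [sup_eq_left.2 h1, sup_eq_left.2 ((hf _ _).1 h1)]
  have hmul : ∀ x y, f (x * y) = f x * f y := fun x y => by
    change _ = IsStar.mul t (f x) (f y)
    rw [IsStar.mul, ← hft]
    by_cases h1 : x ≤ y ⇨ 1
    · rw [if_pos ((hf _ _).1 h1), mul_eq_inf hA h1, hinf]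
    · rw [if_neg (fun h2 => h1 ((hf _ _).2 h2)), mul_eq_sup hA ht h1, hsup]
  refine ⟨f, hmul, fun x y => ?_, hinf, hsup, hf1⟩
  change _ = if f x ≤ f y then t (f x) ⊔ f y else t (f x) ⊓ f y
  by_cases h1 : x ≤ y
  · rw [if_pos ((hf _ _).1 h1), himp_eq_sup hA ht h1, hsup, hft]
  · rw [if_neg (fun h2 => h1 ((hf _ _).2 h2)), himp_eq_inf hA ht h1, hinf, hft]

end Basic

/-- Idempotent totally ordered residuated lattices have the strong amalgamation property. -/
theorem exists_amalgam {A X Y : Type u} [ResiduatedLattice A] [ResiduatedLattice X]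
    [ResiduatedLattice Y] (hX : IsIdempotent X) (tX : IsTotallyOrdered X) (hY : IsIdempotent Y)
    (tY : IsTotallyOrdered Y) (α : Hom A X) (β : Hom A Y)
    (h : ∀ a a', α.toFun a ≤ α.toFun a' ↔ β.toFun a ≤ β.toFun a') :
    ∃ (E : Type u) (_ : ResiduatedLattice E) (f : Hom X E) (g : Hom Y E), IsIdempotent E ∧
      IsTotallyOrdered E ∧ f.comp α = g.comp β ∧
      ∀ x y, f.toFun x = g.toFun y → ∃ a, x = α.toFun a ∧ y = β.toFun a := by
  classical
  let _ : LinearOrder X := @Lattice.toLinearOrder X _ _ _ _ ⟨tX⟩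
  let _ : LinearOrder Y := @Lattice.toLinearOrder Y _ _ _ _ ⟨tY⟩
  have h11 : (1 : X) ⇨ 1 = 1 := one_himp 1
  have h11' : (1 : Y) ⇨ 1 = 1 := one_himp 1
  obtain ⟨E, _, i, t, hE, f, g, hf, hg, hfe, hge, hfs, hgs, hfg, hstrong⟩ :=
    IsStar.exists_amalgam (e := (1 : X)) (s := fun x => x ⇨ 1) (e' := (1 : Y))
      (s' := fun x => x ⇨ 1) ⟨fun _ _ => le_star_comm, h11⟩ ⟨fun _ _ => le_star_comm, h11'⟩
      α.toFun β.toFun h ⟨1, α.map_one, β.map_one⟩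
      (fun a => ⟨a ⇨ 1, by rw [α.map_himp, α.map_one], by rw [β.map_himp, β.map_one]⟩)
  refine ⟨E, hE.residuatedLattice,
    starHom hX tX hE f (fun _ _ => hf.le_iff_le.symm) hfe hfs,
    starHom hY tY hE g (fun _ _ => hg.le_iff_le.symm) hge hgs, fun x => ?_, le_total, ?_, hstrong⟩
  · change IsStar.mul t x x = x
    rw [IsStar.mul, inf_idem, sup_idem, ite_self]
  · exact Hom.ext (funext hfg)

theorem isSemilinear_of_isTotallyOrdered {E : Type u} [ResiduatedLattice E]
    (h : IsTotallyOrdered E) : IsSemilinear E :=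
  ⟨PUnit, fun _ => E, fun _ => inferInstance,
    ⟨fun x _ => x, fun _ _ => rfl, fun _ _ => rfl, fun _ _ => rfl, fun _ _ => rfl, rfl⟩,
    fun _ => h, fun _ _ hxy => congrFun hxy PUnit.unit, fun _ x => ⟨x, rfl⟩⟩

-- Deductive filters and quotients

end ResiduatedLattice

namespace ResiduatedLattice

variable {A : Type u} [ResiduatedLattice A]

/-- Deductive filters of an idempotent residuated lattice: the lattice filters containing `1`. -/
structure IsDedFilter (F : Set A) : Prop where
  one_mem : 1 ∈ F
  mem_of_le : ∀ {x y}, x ≤ y → x ∈ F → y ∈ F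
  inf_mem : ∀ {x y}, x ∈ F → y ∈ F → x ⊓ y ∈ F

theorem himp_himp (x y z : A) : x ⇨ (y ⇨ z) = y * x ⇨ z :=
  eq_of_forall_le_iff fun w => by rw [le_himp_iff, le_himp_iff, le_himp_iff, mul_assoc]

theorem himp_mul_le (x x' y y' : A) : (x ⇨ x') * (y ⇨ y') ≤ x * y ⇨ x' * y' := by
  rw [le_himp_iff, mul_mul_mul_comm]
  exact mul_le_mul_of_le (mul_himp_le x x') (mul_himp_le y y')

theorem le_himp_inf (x y z : A) : (z ⇨ x) ⊓ (z ⇨ y) ≤ z ⇨ x ⊓ y :=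
  le_himp_iff.2 (le_inf (le_himp_iff.1 inf_le_left) (le_himp_iff.1 inf_le_right))

theorem le_sup_himp (x y z : A) : (x ⇨ z) ⊓ (y ⇨ z) ≤ x ⊔ y ⇨ z := by
  rw [le_himp_iff, mul_comm, ← le_himp_iff, sup_le_iff]
  constructor
  · rw [le_himp_iff, mul_comm, ← le_himp_iff]; exact inf_le_left
  · rw [le_himp_iff, mul_comm, ← le_himp_iff]; exact inf_le_right

theorem IsDedFilter.mul_mem (hA : IsIdempotent A) {F : Set A} (hF : IsDedFilter F) {x y : A}
    (hx : x ∈ F) (hy : y ∈ F) : x * y ∈ F := by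
  refine hF.mem_of_le ?_ (hF.inf_mem hx hy)
  rw [← hA (x ⊓ y)]
  exact mul_le_mul_of_le inf_le_left inf_le_right

/-- A deductive filter of an idempotent residuated lattice, as bundled data. -/
structure DedFilter (A : Type u) [ResiduatedLattice A] where
  carrier : Set A
  isDedFilter : IsDedFilter carrier
  idem : IsIdempotent A

namespace DedFilter

variable (F : DedFilter A)

/-- The preorder determined by a deductive filter. -/
def Le (x y : A) : Prop := x ⇨ y ∈ F.carrier

variable {F}

theorem le_of_le {x y : A} (h : x ≤ y) : F.Le x y :=
  F.isDedFilter.mem_of_le (one_le_himp_iff.2 h) F.isDedFilter.one_mem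

theorem le_trans {x y z : A} (h : F.Le x y) (h' : F.Le y z) : F.Le x z :=
  F.isDedFilter.mem_of_le (himp_mul_himp_le x y z) (F.isDedFilter.mul_mem F.idem h h')

theorem mul_le_mul {x x' y y' : A} (h : F.Le x x') (h' : F.Le y y') : F.Le (x * y) (x' * y') :=
  F.isDedFilter.mem_of_le (himp_mul_le x x' y y') (F.isDedFilter.mul_mem F.idem h h')

theorem mul_le_iff {x y z : A} : F.Le (x * y) z ↔ F.Le y (x ⇨ z) := by
  rw [Le, Le, himp_himp]

theorem himp_le {x x' y y' : A} (h : F.Le x' x) (h' : F.Le y y') : F.Le (x ⇨ y) (x' ⇨ y') :=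
  mul_le_iff.1 (le_trans (mul_le_mul h (le_of_le le_rfl))
    (le_trans (le_of_le (mul_himp_le x y)) h'))

theorem le_inf' {x y z : A} (h : F.Le z x) (h' : F.Le z y) : F.Le z (x ⊓ y) :=
  F.isDedFilter.mem_of_le (le_himp_inf x y z) (F.isDedFilter.inf_mem h h')

theorem sup_le' {x y z : A} (h : F.Le x z) (h' : F.Le y z) : F.Le (x ⊔ y) z :=
  F.isDedFilter.mem_of_le (le_sup_himp x y z) (F.isDedFilter.inf_mem h h')

theorem inf_le_inf' {x x' y y' : A} (h : F.Le x x') (h' : F.Le y y') : F.Le (x ⊓ y) (x' ⊓ y') :=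
  le_inf' (le_trans (le_of_le inf_le_left) h) (le_trans (le_of_le inf_le_right) h')

theorem sup_le_sup' {x x' y y' : A} (h : F.Le x x') (h' : F.Le y y') : F.Le (x ⊔ y) (x' ⊔ y') :=
  sup_le' (le_trans h (le_of_le le_sup_left)) (le_trans h' (le_of_le le_sup_right))

variable (F)

/-- The congruence of a deductive filter. -/
def Rel (x y : A) : Prop := F.Le x y ∧ F.Le y x

/-- The congruence of a deductive filter, as a setoid. -/
@[reducible] def setoid : Setoid A where
  r := F.Rel
  iseqv := ⟨fun _ => ⟨le_of_le le_rfl, le_of_le le_rfl⟩, fun h => ⟨h.2, h.1⟩,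
    fun h h' => ⟨le_trans h.1 h'.1, le_trans h'.2 h.2⟩⟩

/-- The quotient by a deductive filter. -/
def Quo : Type u := Quotient F.setoid

variable {F}

/-- The class of an element. -/
def toQuo (x : A) : Quo F := Quotient.mk F.setoid x

theorem mk_surjective (q : Quo F) : ∃ x, toQuo x = q := Quotient.exists_rep q

theorem toQuo_eq_iff {x y : A} : (toQuo x : Quo F) = toQuo y ↔ F.Rel x y :=
  ⟨fun h => Quotient.exact h, fun h => Quotient.sound h⟩

theorem Rel.symm {x y : A} (h : F.Rel x y) : F.Rel y x := ⟨h.2, h.1⟩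

theorem Rel.trans {x y z : A} (h : F.Rel x y) (h' : F.Rel y z) : F.Rel x z :=
  ⟨le_trans h.1 h'.1, le_trans h'.2 h.2⟩

/-- The binary operation on the quotient induced by a compatible one. -/
def map₂ (m : A → A → A) (hm : ∀ x x', F.Rel x x' → ∀ y y', F.Rel y y' →
    F.Rel (m x y) (m x' y')) : Quo F → Quo F → Quo F :=
  Quotient.map₂ m fun x x' h y y' h' => hm x x' h y y' h'

variable (F)

instance : LE (Quo F) where
  le := Quotient.lift₂ F.Le fun _ _ _ _ h h' =>
    propext ⟨fun k => le_trans h.2 (le_trans k h'.1), fun k => le_trans h.1 (le_trans k h'.2)⟩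

instance : ResiduatedLattice (Quo F) where
  mul := map₂ (· * ·) fun _ _ h _ _ h' => ⟨mul_le_mul h.1 h'.1, mul_le_mul h.2 h'.2⟩
  one := toQuo 1
  himp := map₂ (· ⇨ ·) fun _ _ h _ _ h' => ⟨himp_le h.2 h'.1, himp_le h.1 h'.2⟩
  inf := map₂ (· ⊓ ·) fun _ _ h _ _ h' => ⟨inf_le_inf' h.1 h'.1, inf_le_inf' h.2 h'.2⟩
  sup := map₂ (· ⊔ ·) fun _ _ h _ _ h' => ⟨sup_le_sup' h.1 h'.1, sup_le_sup' h.2 h'.2⟩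
  mul_assoc p q r := by
    obtain ⟨x, rfl⟩ := mk_surjective p
    obtain ⟨y, rfl⟩ := mk_surjective q
    obtain ⟨z, rfl⟩ := mk_surjective r
    exact congrArg toQuo (mul_assoc x y z)
  mul_comm p q := by
    obtain ⟨x, rfl⟩ := mk_surjective p
    obtain ⟨y, rfl⟩ := mk_surjective q
    exact congrArg toQuo (mul_comm x y)
  one_mul p := by
    obtain ⟨x, rfl⟩ := mk_surjective p
    exact congrArg toQuo (one_mul x)
  mul_one p := by
    obtain ⟨x, rfl⟩ := mk_surjective p
    exact congrArg toQuo (mul_one x)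
  le_refl p := by
    obtain ⟨x, rfl⟩ := mk_surjective p
    exact le_of_le (F := F) le_rfl
  le_trans p q r h h' := by
    obtain ⟨x, rfl⟩ := mk_surjective p
    obtain ⟨y, rfl⟩ := mk_surjective q
    obtain ⟨z, rfl⟩ := mk_surjective r
    exact le_trans (F := F) h h'
  le_antisymm p q h h' := by
    obtain ⟨x, rfl⟩ := mk_surjective p
    obtain ⟨y, rfl⟩ := mk_surjective q
    exact toQuo_eq_iff.2 ⟨h, h'⟩
  inf_le_left p q := by
    obtain ⟨x, rfl⟩ := mk_surjective p
    obtain ⟨y, rfl⟩ := mk_surjective q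
    exact le_of_le (F := F) (inf_le_left (a := x) (b := y))
  inf_le_right p q := by
    obtain ⟨x, rfl⟩ := mk_surjective p
    obtain ⟨y, rfl⟩ := mk_surjective q
    exact le_of_le (F := F) (inf_le_right (a := x) (b := y))
  le_inf p q r h h' := by
    obtain ⟨x, rfl⟩ := mk_surjective p
    obtain ⟨y, rfl⟩ := mk_surjective q
    obtain ⟨z, rfl⟩ := mk_surjective r
    exact le_inf' (F := F) (x := y) (y := z) (z := x) h h'
  le_sup_left p q := by
    obtain ⟨x, rfl⟩ := mk_surjective p
    obtain ⟨y, rfl⟩ := mk_surjective q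
    exact le_of_le (F := F) (le_sup_left (a := x) (b := y))
  le_sup_right p q := by
    obtain ⟨x, rfl⟩ := mk_surjective p
    obtain ⟨y, rfl⟩ := mk_surjective q
    exact le_of_le (F := F) (le_sup_right (a := x) (b := y))
  sup_le p q r h h' := by
    obtain ⟨x, rfl⟩ := mk_surjective p
    obtain ⟨y, rfl⟩ := mk_surjective q
    obtain ⟨z, rfl⟩ := mk_surjective r
    exact sup_le' (F := F) (x := x) (y := y) (z := z) h h'
  mul_le_iff_le_himp p q r := by
    obtain ⟨x, rfl⟩ := mk_surjective p
    obtain ⟨y, rfl⟩ := mk_surjective q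
    obtain ⟨z, rfl⟩ := mk_surjective r
    exact mul_le_iff (F := F) (x := x) (y := y) (z := z)

/-- The canonical homomorphism onto the quotient. -/
def mkHom : Hom A (Quo F) :=
  ⟨toQuo, fun _ _ => rfl, fun _ _ => rfl, fun _ _ => rfl, fun _ _ => rfl, rfl⟩

theorem isIdempotent_quo : IsIdempotent (Quo F) := fun p => by
  obtain ⟨x, rfl⟩ := mk_surjective p
  exact congrArg toQuo (F.idem x)

theorem isTotallyOrdered_quo (h : ∀ x y, F.Le x y ∨ F.Le y x) : IsTotallyOrdered (Quo F) :=
  fun p q => by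
    obtain ⟨x, rfl⟩ := mk_surjective p
    obtain ⟨y, rfl⟩ := mk_surjective q
    exact h x y

end DedFilter

end ResiduatedLattice

/-! ### Epimorphisms and pairs of total quotients -/

namespace ResiduatedLattice

theorem Hom.monotone {A : Type u} {B : Type v} [ResiduatedLattice A] [ResiduatedLattice B]
    (f : Hom A B) {x y : A} (h : x ≤ y) : f.toFun x ≤ f.toFun y := by
  rw [← inf_eq_left, ← f.map_inf, inf_eq_left.2 h]

theorem inf_le_mul {A : Type u} [ResiduatedLattice A] (hA : IsIdempotent A) (x y : A) :
    x ⊓ y ≤ x * y := by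
  rw [← hA (x ⊓ y)]
  exact mul_le_mul_of_le inf_le_left inf_le_right

theorem mul_le_left_of_le_one {A : Type u} [ResiduatedLattice A] {x y : A} (h : x ≤ 1) :
    x * y ≤ y :=
  (mul_le_mul_right_of_le h y).trans_eq (one_mul y)

variable {A B : Type u} [ResiduatedLattice A] [ResiduatedLattice B]

namespace DedFilter

/-- The deductive filter of `B` generated by `F` and the elements of `G` in the range of `f`. -/
def join (f : Hom A B) (F G : DedFilter B) : DedFilter B where
  carrier := {b | ∃ x ∈ F.carrier, ∃ a, f.toFun a ∈ G.carrier ∧ x ⊓ f.toFun a ≤ b}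
  isDedFilter :=
    { one_mem := ⟨1, F.isDedFilter.one_mem, 1, by rw [f.map_one]; exact G.isDedFilter.one_mem,
        inf_le_left⟩
      mem_of_le := fun h ⟨x, hx, a, ha, hxa⟩ => ⟨x, hx, a, ha, hxa.trans h⟩
      inf_mem := fun ⟨x, hx, a, ha, hxa⟩ ⟨y, hy, b, hb, hyb⟩ =>
        ⟨x ⊓ y, F.isDedFilter.inf_mem hx hy, a ⊓ b, by
          rw [f.map_inf]; exact G.isDedFilter.inf_mem ha hb, by
          rw [f.map_inf, inf_inf_inf_comm]; exact inf_le_inf hxa hyb⟩ }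
  idem := F.idem

variable {f : Hom A B} {F G : DedFilter B}

theorem le_join {x y : B} (h : F.Le x y) : (join f F G).Le x y :=
  ⟨_, h, 1, by rw [f.map_one]; exact G.isDedFilter.one_mem, inf_le_left⟩

/-- The element of `F` witnessing membership need not come from `A`, but by residuation it can be
replaced by `(a ⊓ 1) ⇨ c`, which does. The two filters then play symmetric roles, so `join f F G`
and `join f G F` have the same trace on the range of `f`. -/
theorem exists_mul_le_of_mem_join {c : A} (h : f.toFun c ∈ (join f F G).carrier) :
    ∃ p q, p ≤ 1 ∧ q ≤ 1 ∧ f.toFun p ∈ F.carrier ∧ f.toFun q ∈ G.carrier ∧ p * q ≤ c := by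
  obtain ⟨x, hx, a, ha, hxa⟩ := h
  refine ⟨((a ⊓ 1) ⇨ c) ⊓ 1, a ⊓ 1, inf_le_right, inf_le_right, ?_, ?_, ?_⟩
  · rw [f.map_inf, f.map_himp, f.map_inf, f.map_one]
    refine F.isDedFilter.inf_mem (F.isDedFilter.mem_of_le (x := x ⊓ 1) ?_
      (F.isDedFilter.inf_mem hx F.isDedFilter.one_mem)) F.isDedFilter.one_mem
    rw [le_himp_iff]
    refine (le_inf ?_ ?_).trans hxa
    · exact (mul_le_left_of_le_one inf_le_right).trans inf_le_left
    · rw [mul_comm]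
      exact (mul_le_left_of_le_one inf_le_right).trans inf_le_left
  · rw [f.map_inf, f.map_one]
    exact G.isDedFilter.inf_mem ha G.isDedFilter.one_mem
  · rw [mul_comm]
    exact le_himp_iff.1 inf_le_left

theorem mem_join_comm {c : A} (h : f.toFun c ∈ (join f F G).carrier) :
    f.toFun c ∈ (join f G F).carrier := by
  obtain ⟨p, q, -, -, hp, hq, hpq⟩ := exists_mul_le_of_mem_join h
  refine ⟨f.toFun q, hq, p, hp, (inf_le_mul F.idem _ _).trans ?_⟩
  rw [mul_comm, ← f.map_mul]
  exact f.monotone hpq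

end DedFilter

open DedFilter

/-- Equal traces make the two quotients order the image of `A` alike, so they amalgamate. The two
composites from `B` into the amalgam agree on `f`, hence are equal, and strongness places the class
of `b` in the image of `A`. -/
theorem IsEpimorphism.exists_rel_of_mem_iff {f : Hom A B}
    (hf : IsEpimorphism (fun A _ => IsIdempotentSemilinear A) f) {F G : DedFilter B}
    (hF : ∀ x y, F.Le x y ∨ F.Le y x) (hG : ∀ x y, G.Le x y ∨ G.Le y x)
    (h : ∀ a, f.toFun a ∈ F.carrier ↔ f.toFun a ∈ G.carrier) (b : B) :
    ∃ a, F.Rel b (f.toFun a) ∧ G.Rel b (f.toFun a) := by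
  obtain ⟨E, _, u, v, hE, tE, huv, hstrong⟩ := exists_amalgam (isIdempotent_quo F)
    (isTotallyOrdered_quo F hF) (isIdempotent_quo G) (isTotallyOrdered_quo G hG)
    (F.mkHom.comp f) (G.mkHom.comp f) (fun a a' => by
      change f.toFun a ⇨ f.toFun a' ∈ F.carrier ↔ f.toFun a ⇨ f.toFun a' ∈ G.carrier
      rw [← f.map_himp, h])
  have h1 := hf E ⟨hE, isSemilinear_of_isTotallyOrdered tE⟩ (u.comp F.mkHom) (v.comp G.mkHom) huv
  obtain ⟨a, ha, ha'⟩ := hstrong (toQuo b) (toQuo b) (congrArg (fun k => k.toFun b) h1)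
  exact ⟨a, toQuo_eq_iff.1 ha, toQuo_eq_iff.1 ha'⟩

theorem IsEpimorphism.exists_rel {f : Hom A B}
    (hf : IsEpimorphism (fun A _ => IsIdempotentSemilinear A) f) {F G : DedFilter B}
    (hF : ∀ x y, F.Le x y ∨ F.Le y x) (hG : ∀ x y, G.Le x y ∨ G.Le y x) (b : B) :
    ∃ a, F.Rel b (f.toFun a) ∧ G.Rel b (f.toFun a) := by
  obtain ⟨a₁, h₁, -⟩ := hf.exists_rel_of_mem_iff hF hF (fun _ => Iff.rfl) b
  obtain ⟨a₂, h₂, -⟩ := hf.exists_rel_of_mem_iff hG hG (fun _ => Iff.rfl) b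
  -- The joins contain `F` and `G` respectively, so they stay total, and their traces agree.
  -- Comparing `a₁` and `a₂` with `a` makes `a₁` and `a₂` congruent modulo `join f F G`.
  obtain ⟨a, ha, ha'⟩ := hf.exists_rel_of_mem_iff (F := join f F G) (G := join f G F)
    (fun x y => (hF x y).imp le_join le_join) (fun x y => (hG x y).imp le_join le_join)
    (fun _ => ⟨mem_join_comm, mem_join_comm⟩) b
  have k₁ : (join f F G).Rel (f.toFun a₁) (f.toFun a) :=
    Rel.trans ⟨le_join h₁.2, le_join h₁.1⟩ ha
  have k₂ : (join f G F).Rel (f.toFun a₂) (f.toFun a) :=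
    Rel.trans ⟨le_join h₂.2, le_join h₂.1⟩ ha'
  have k₃ : (join f F G).Rel (f.toFun a₂) (f.toFun a) := by
    have : ∀ x y, (join f G F).Le (f.toFun x) (f.toFun y) →
        (join f F G).Le (f.toFun x) (f.toFun y) := fun x y h => by
      rw [Le, ← f.map_himp] at h ⊢
      exact mem_join_comm h
    exact ⟨this _ _ k₂.1, this _ _ k₂.2⟩
  have k : f.toFun ((a₁ ⇨ a₂) ⊓ (a₂ ⇨ a₁)) ∈ (join f F G).carrier := by
    rw [f.map_inf, f.map_himp, f.map_himp]
    exact (join f F G).isDedFilter.inf_mem (k₁.trans k₃.symm).1 (k₁.trans k₃.symm).2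
  obtain ⟨p, q, hp1, hq1, hp, hq, hpq⟩ := exists_mul_le_of_mem_join k
  have e₁ : p * (q * a₂) ≤ a₁ := by
    rw [← mul_assoc, mul_comm, ← le_himp_iff]
    exact hpq.trans inf_le_right
  have e₂ : q * (p * a₁) ≤ a₂ := by
    rw [← mul_assoc, mul_comm q, mul_comm, ← le_himp_iff]
    exact hpq.trans inf_le_left
  have e₃ : p * (p * a₁) ≤ a₁ := (mul_le_left_of_le_one hp1).trans (mul_le_left_of_le_one hp1)
  have e₄ : q * (q * a₂) ≤ a₂ := (mul_le_left_of_le_one hq1).trans (mul_le_left_of_le_one hq1)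
  have mF : ∀ {x y}, p * x ≤ y → F.Le (f.toFun x) (f.toFun y) := fun {x y} h => by
    rw [Le, ← f.map_himp]
    exact F.isDedFilter.mem_of_le (f.monotone (le_himp_iff.2 (by rwa [mul_comm]))) hp
  have mG : ∀ {x y}, q * x ≤ y → G.Le (f.toFun x) (f.toFun y) := fun {x y} h => by
    rw [Le, ← f.map_himp]
    exact G.isDedFilter.mem_of_le (f.monotone (le_himp_iff.2 (by rwa [mul_comm]))) hq
  -- Chinese-remainder witness: modulo `F` the factor `p` acts as `1`, and `e₁` puts `q * a₂` below
  -- `a₁`; modulo `G` the roles are exchanged.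
  refine ⟨p * a₁ ⊔ q * a₂, h₁.trans ⟨mF le_sup_left, mF ?_⟩, h₂.trans ⟨mG le_sup_right, mG ?_⟩⟩
  · rw [mul_le_iff_le_himp]
    exact sup_le ((mul_le_iff_le_himp _ _ _).1 e₃) ((mul_le_iff_le_himp _ _ _).1 e₁)
  · rw [mul_le_iff_le_himp]
    exact sup_le ((mul_le_iff_le_himp _ _ _).1 e₂) ((mul_le_iff_le_himp _ _ _).1 e₄)

/-! ### Compactness over ultrafilters -/

/-- An ideal of sets that meets every ultrafilter is improper. -/
theorem univ_mem_of_forall_ultrafilter {ι : Type u} (P : Set ι → Prop) (h0 : P ∅)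
    (hmono : ∀ S T, S ⊆ T → P T → P S) (hunion : ∀ S T, P S → P T → P (S ∪ T))
    (hU : ∀ U : Ultrafilter ι, ∃ S ∈ U, P S) : P Set.univ := by
  by_contra hP
  -- Were the ideal proper, its dual filter would extend to an ultrafilter, which would contain a
  -- member of the ideal together with its complement.
  let l : Filter ι :=
    { sets := {S | P Sᶜ}
      univ_sets := by simpa using h0
      sets_of_superset := fun {S T} hS hST => hmono _ _ (Set.compl_subset_compl.2 hST) hS
      inter_sets := fun {S T} hS hT => by
        rw [Set.mem_ofPred_eq, Set.compl_inter]
        exact hunion _ _ hS hT }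
  have hl : l.NeBot := ⟨fun h => hP (by
    have : (∅ : Set ι) ∈ l := h ▸ Filter.mem_bot
    change P ∅ᶜ at this
    rwa [Set.compl_empty] at this)⟩
  obtain ⟨S, hS, hPS⟩ := hU (Ultrafilter.of l)
  have : Sᶜ ∈ l := by
    change P Sᶜᶜ
    rwa [compl_compl]
  exact (Ultrafilter.compl_mem_iff_notMem.1 (Ultrafilter.of_le l this)) hS

section Ultra

variable {ι : Type u} {C : ι → Type u} [∀ i, ResiduatedLattice (C i)]

/-- The deductive filter of the ultraproduct of a family of homomorphisms. -/
def ultraFilter (hB : IsIdempotent B) (φ : Hom B (∀ i, C i)) (U : Ultrafilter ι) :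
    DedFilter B where
  carrier := {b | {i | 1 ≤ φ.toFun b i} ∈ U}
  isDedFilter :=
    { one_mem := by
        refine Filter.mem_of_superset Filter.univ_mem fun i _ => ?_
        change 1 ≤ φ.toFun 1 i
        rw [φ.map_one]
        exact le_rfl
      mem_of_le := fun h hx => Filter.mem_of_superset hx fun i hi => le_trans hi (φ.monotone h i)
      inf_mem := fun {x y} hx hy => by
        refine Filter.mem_of_superset (Filter.inter_mem hx hy) fun i hi => ?_
        change 1 ≤ φ.toFun (x ⊓ y) i
        rw [φ.map_inf]
        exact le_inf hi.1 hi.2 }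
  idem := hB

theorem ultraFilter_le_iff (hB : IsIdempotent B) (φ : Hom B (∀ i, C i)) (U : Ultrafilter ι)
    {x y : B} : (ultraFilter hB φ U).Le x y ↔ {i | φ.toFun x i ≤ φ.toFun y i} ∈ U := by
  have : {i | 1 ≤ φ.toFun (x ⇨ y) i} = {i | φ.toFun x i ≤ φ.toFun y i} := by
    ext i
    rw [Set.mem_ofPred_eq, Set.mem_ofPred_eq, φ.map_himp]
    exact one_le_himp_iff
  rw [← this]
  rfl

end Ultra

theorem IsEpimorphism.surjective {f : Hom A B} (hB : IsIdempotentSemilinear B)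
    (hf : IsEpimorphism (fun A _ => IsIdempotentSemilinear A) f) : Function.Surjective f := by
  obtain ⟨hI, ι, C, _, φ, hC, hφ, -⟩ := hB
  intro b
  have hle : ∀ {x y : B}, (∀ i, φ.toFun x i ≤ φ.toFun y i) → x ≤ y := fun {x y} h => by
    rw [← inf_eq_left]
    refine hφ ?_
    change φ.toFun (x ⊓ y) = φ.toFun x
    rw [φ.map_inf]
    exact inf_eq_left.2 h
  have htot : ∀ U x y, (ultraFilter hI φ U).Le x y ∨ (ultraFilter hI φ U).Le y x := by
    intro U x y
    rw [ultraFilter_le_iff, ultraFilter_le_iff, ← Ultrafilter.union_mem_iff]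
    exact Filter.mem_of_superset Filter.univ_mem fun i _ => hC i _ _
  have hpair : ∀ U V : Ultrafilter ι, ∃ a, {i | φ.toFun b i ≤ φ.toFun (f.toFun a) i} ∈ U ∧
      {i | φ.toFun (f.toFun a) i ≤ φ.toFun b i} ∈ V := by
    intro U V
    obtain ⟨a, h1, h2⟩ := hf.exists_rel (htot U) (htot V) b
    exact ⟨a, (ultraFilter_le_iff hI φ U).1 h1.1, (ultraFilter_le_iff hI φ V).1 h2.2⟩
  -- For empty `ι` the algebra `B` is trivial. Otherwise a principal ultrafilter supplies the
  -- initial `a` with `f a ≤ b` needed for the empty set below.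
  rcases isEmpty_or_nonempty ι with hι | ⟨⟨i₀⟩⟩
  · exact ⟨1, le_antisymm (hle fun i => hι.elim i) (hle fun i => hι.elim i)⟩
  have hbelow : ∀ U : Ultrafilter ι, ∃ a, {i | φ.toFun b i ≤ φ.toFun (f.toFun a) i} ∈ U ∧
      ∀ i ∈ Set.univ, φ.toFun (f.toFun a) i ≤ φ.toFun b i := by
    intro U
    -- With `U` fixed, the sets on which some admissible `f a` lies below `b` form an ideal: unions
    -- are handled by meets of witnesses.
    refine univ_mem_of_forall_ultrafilter (fun S =>
      ∃ a, {i | φ.toFun b i ≤ φ.toFun (f.toFun a) i} ∈ U ∧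
        ∀ i ∈ S, φ.toFun (f.toFun a) i ≤ φ.toFun b i) ?_ ?_ ?_ ?_
    · obtain ⟨a, ha, -⟩ := hpair U U
      exact ⟨a, ha, fun i hi => hi.elim⟩
    · exact fun S T hST ⟨a, h1, h2⟩ => ⟨a, h1, fun i hi => h2 i (hST hi)⟩
    · rintro S T ⟨a, h1, h2⟩ ⟨a', h1', h2'⟩
      refine ⟨a ⊓ a', Filter.mem_of_superset (Filter.inter_mem h1 h1') fun i hi => ?_,
        fun i hi => ?_⟩
      · rw [Set.mem_ofPred_eq, f.map_inf, φ.map_inf]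
        exact le_inf hi.1 hi.2
      · rw [f.map_inf, φ.map_inf]
        rcases hi with hi | hi
        · exact inf_le_of_left_le (h2 i hi)
        · exact inf_le_of_right_le (h2' i hi)
    · intro V
      obtain ⟨a, h1, h2⟩ := hpair U V
      exact ⟨_, h2, a, h1, fun i hi => hi⟩
  -- The dual argument, now with `f a ≤ b` everywhere: unions are handled by joins.
  obtain ⟨a, h1, h2⟩ := univ_mem_of_forall_ultrafilter (fun S => ∃ a, f.toFun a ≤ b ∧
      ∀ i ∈ S, φ.toFun b i ≤ φ.toFun (f.toFun a) i) (by
    obtain ⟨a, -, h⟩ := hbelow (pure i₀)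
    exact ⟨a, hle fun i => h i trivial, fun i hi => hi.elim⟩)
    (fun S T hST ⟨a, h1, h2⟩ => ⟨a, h1, fun i hi => h2 i (hST hi)⟩) (by
    rintro S T ⟨a, h1, h2⟩ ⟨a', h1', h2'⟩
    refine ⟨a ⊔ a', by rw [f.map_sup]; exact sup_le h1 h1', fun i hi => ?_⟩
    rw [f.map_sup, φ.map_sup]
    rcases hi with hi | hi
    · exact le_sup_of_le_left (h2 i hi)
    · exact le_sup_of_le_right (h2' i hi)) (fun U => by
    obtain ⟨a, h1, h2⟩ := hbelow U
    exact ⟨_, h1, a, hle fun i => h2 i trivial, fun i hi => hi⟩)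
  exact ⟨a, le_antisymm h1 (hle fun i => h2 i trivial)⟩

end ResiduatedLattice

theorem mainTheorem5 :
    ResiduatedLattice.HasSurjectiveEpimorphisms.{u}
      (fun A _ => ResiduatedLattice.IsIdempotentSemilinear A) := by
  intro A B _ _ _ hB f hf
  exact hf.surjective hB
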